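/- Let $X$ be a topological space. A neighborhood assignment on $X$ is a map $U$ assigning to each point $x\in X$ an open set $U(x)$ with $x\in U(x)$; a set $A\subseteq X$ pins down $U$ if $A\cap U(x)\neq\emptyset$ for all $x\in X$. The pinning down number $\mathrm{pd}(X)$ is the smallest cardinal $\kappa$ such that every neighborhood assignment on $X$ is pinned down by some set $A\subseteq X$ with $|A|\le\kappa$, and the density $d(X)$ is the smallest cardinality of a dense subset of $X$ (finite values are allowed for both). Theorem. For every regular space $X$ (a space in which every point and every closed set not containing it have disjoint neighborhoods; no $T_0$ or $T_1$ axiom is needed) we have $$d(X)<2^{\mathrm{pd}(X)}.$$ -/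

import Mathlib

universe u

open Cardinal

/-- A neighborhood assignment on `X`: every point `x` is assigned an open set `U x`
containing `x`. -/
def IsNeighborhoodAssignment {X : Type u} [TopologicalSpace X] (U : X → Set X) : Prop :=
  ∀ x : X, IsOpen (U x) ∧ x ∈ U x

/-- `A` pins down `U` if `A` meets `U x` for every `x`. -/
def PinsDown {X : Type u} (A : Set X) (U : X → Set X) : Prop :=
  ∀ x : X, (A ∩ U x).Nonempty

/-- The pinning down number `pd(X)`: the smallest cardinal `κ` such that every neighborhood
assignment on `X` is pinned down by a set of size at most `κ`. -/
noncomputable def pinningDownNumber (X : Type u) [TopologicalSpace X] : Cardinal.{u} :=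
  sInf {κ : Cardinal.{u} | ∀ U : X → Set X, IsNeighborhoodAssignment U →
    ∃ A : Set X, #A ≤ κ ∧ PinsDown A U}

/-- The density `d(X)`: the smallest cardinality of a dense subset of `X`
(finite values are allowed). -/
noncomputable def densityNumber (X : Type u) [TopologicalSpace X] : Cardinal.{u} :=
  sInf {κ : Cardinal.{u} | ∃ D : Set X, Dense D ∧ #D = κ}

/-- The infimum defining `pd(X)` is attained. -/
theorem pinningDownNumber_spec (X : Type u) [TopologicalSpace X] :
    ∀ U : X → Set X, IsNeighborhoodAssignment U →
      ∃ A : Set X, #A ≤ pinningDownNumber X ∧ PinsDown A U :=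
  csInf_mem (s := {κ : Cardinal.{u} | ∀ U : X → Set X, IsNeighborhoodAssignment U →
    ∃ A : Set X, #A ≤ κ ∧ PinsDown A U})
    ⟨#X, fun _ hU => ⟨Set.univ, Cardinal.mk_univ.le, fun x => ⟨x, Set.mem_univ x, (hU x).2⟩⟩⟩

/-- The infimum defining `d(X)` is attained. -/
theorem densityNumber_spec (X : Type u) [TopologicalSpace X] :
    ∃ D : Set X, Dense D ∧ #D = densityNumber X :=
  csInf_mem (s := {κ : Cardinal.{u} | ∃ D : Set X, Dense D ∧ #D = κ})
    ⟨#(Set.univ : Set X), Set.univ, dense_univ, rfl⟩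

/-! Write κ = pd(X). Disjoint open families have at most κ members. For finite κ this bounds the
Hausdorff Kolmogorov quotient by κ points. For infinite κ, König's inequality reduces the claim to
finding, inside each nonempty open G, a nonempty open piece of density below 2^κ.

If G has no such piece, all its nonempty open subsets have at least 2^κ points. Now a family of open
sets, each at least as large as the index set, admits distinct representatives, so one set of size κ
meets all members. If some nonempty open V ⊆ G has at most 2^κ points, apply this to the sets V \
closure A with A ⊆ V and |A| ≤ κ. Otherwise apply it to differences of regular open sets: their
traces on a set of size κ determine them, so there are at most 2^κ of them. By regularity they form
a base of G, and pinning them gives a set of size κ dense in G. -/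

/-- A family of sets, each at least as large as the index type, has an injective choice function. -/
theorem exists_injective_choice {ι X : Type u} (V : ι → Set X) (h : ∀ i, #ι ≤ #(V i)) :
    ∃ f : ι → X, Function.Injective f ∧ ∀ i, f i ∈ V i := by
  classical
  -- In a well-order of initial order type, fewer than `#ι` points are used up before each stage.
  obtain ⟨r, wo, hr⟩ := Cardinal.exists_ord_eq ι
  have fresh : ∀ (i : ι) (g : ∀ j, r j i → X), ∃ x ∈ V i, ∀ j hj, g j hj ≠ x := by
    intro i g
    by_contra! hc
    have hsub : V i ⊆ Set.range (fun j : {j // r j i} => g j.1 j.2) := by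
      intro x hx
      obtain ⟨j, hj, rfl⟩ := hc x hx
      exact ⟨⟨j, hj⟩, rfl⟩
    have hlt : #{j // r j i} < #ι := by
      have := Ordinal.typein_lt_type r i
      rw [← hr, Cardinal.lt_ord] at this
      exact this
    exact absurd ((h i).trans ((mk_le_mk_of_subset hsub).trans mk_range_le)) (not_le.2 hlt)
  choose F hF hF' using fresh
  let f : ι → X := wo.wf.fix F
  have hf : ∀ i, f i = F i (fun j _ => f j) := fun i => wo.wf.fix_eq F i
  have hne : ∀ i j, r j i → f j ≠ f i := fun i j hj => by
    rw [hf i]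
    exact hF' i (fun j _ => f j) j hj
  refine ⟨f, fun i j hij => ?_, fun i => ?_⟩
  · rcases trichotomous_of r i j with h' | h' | h'
    · exact absurd hij (hne j i h')
    · exact h'
    · exact absurd hij.symm (hne i j h')
  · rw [hf i]
    exact hF i _

section PinningDown

variable {X : Type u} [TopologicalSpace X]

/-- Open neighborhoods of distinct points are met by a single set of size at most `pd(X)`. -/
theorem exists_pinning_of_injective {ι : Type u} {f : ι → X} (hf : Function.Injective f)
    {V : ι → Set X} (hV : ∀ i, IsOpen (V i)) (hfV : ∀ i, f i ∈ V i) :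
    ∃ A : Set X, #A ≤ pinningDownNumber X ∧ ∀ i, (A ∩ V i).Nonempty := by
  obtain ⟨A, hA, hAU⟩ := pinningDownNumber_spec X
    (Function.extend f V fun _ => Set.univ) (fun x => by
      by_cases hx : ∃ i, f i = x
      · obtain ⟨i, rfl⟩ := hx
        rw [hf.extend_apply]
        exact ⟨hV i, hfV i⟩
      · rw [Function.extend_apply' _ _ _ hx]
        exact ⟨isOpen_univ, Set.mem_univ x⟩)
  refine ⟨A, hA, fun i => ?_⟩
  have := hAU (f i)
  rwa [hf.extend_apply] at this

/-- A family of open sets, each at least as large as the index type, is met by a single set of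
size at most `pd(X)`. -/
theorem exists_pinning_of_mk_le {ι : Type u} {V : ι → Set X} (hV : ∀ i, IsOpen (V i))
    (h : ∀ i, #ι ≤ #(V i)) :
    ∃ A : Set X, #A ≤ pinningDownNumber X ∧ ∀ i, (A ∩ V i).Nonempty := by
  obtain ⟨f, hf, hfV⟩ := exists_injective_choice V h
  exact exists_pinning_of_injective hf hV hfV

/-- The cellularity is at most the pinning down number. -/
theorem mk_le_pinningDownNumber_of_pairwise_disjoint {ι : Type u} {V : ι → Set X}
    (hV : ∀ i, IsOpen (V i)) (hne : ∀ i, (V i).Nonempty)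
    (hd : Pairwise (Function.onFun Disjoint V)) : #ι ≤ pinningDownNumber X := by
  have inj : ∀ g : ι → X, (∀ i, g i ∈ V i) → Function.Injective g := fun g hg i j hij => by
    by_contra hne
    exact Set.disjoint_left.1 (hd hne) (hg i) (hij ▸ hg j)
  choose f hf using hne
  obtain ⟨A, hA, hAV⟩ := exists_pinning_of_injective (inj f hf) hV hf
  -- Points of `A` taken from disjoint sets are distinct, so `A` has at least `#ι` points.
  choose g hg using hAV
  have hginj := inj g fun i => (hg i).2
  refine le_trans ?_ hA
  exact mk_le_of_injective (f := fun i => (⟨g i, (hg i).1⟩ : A))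
    fun i j hij => hginj (congrArg Subtype.val hij)

theorem densityNumber_le {D : Set X} (hD : Dense D) : densityNumber X ≤ #D :=
  csInf_le' ⟨D, hD, rfl⟩

/-- If `pd(X)` is finite and `X` is regular, then `d(X) ≤ pd(X)`. -/
theorem densityNumber_le_of_pinningDownNumber_lt_aleph0 [RegularSpace X]
    (h : pinningDownNumber X < ℵ₀) : densityNumber X ≤ pinningDownNumber X := by
  have hQ : #(SeparationQuotient X) ≤ pinningDownNumber X := by
    by_contra! hlt
    -- One point more than pd(X): still finitely many, hence simultaneously separated by disjoint
    -- open sets.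
    obtain ⟨t, ht⟩ := le_mk_iff_exists_set.1 (Order.succ_le_of_lt hlt)
    have hfin : t.Finite := by
      rw [← lt_aleph0_iff_set_finite, ht]
      exact isSuccLimit_aleph0.succ_lt h
    obtain ⟨U, hU, hdisj⟩ := hfin.t2_separation
    have := mk_le_pinningDownNumber_of_pairwise_disjoint
      (V := fun i : t => SeparationQuotient.mk ⁻¹' U i.1)
      (fun i => (hU i.1).2.preimage SeparationQuotient.continuous_mk)
      (fun i => by
        obtain ⟨x, hx⟩ := SeparationQuotient.surjective_mk i.1
        exact ⟨x, by simpa [hx] using (hU i.1).1⟩)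
      (fun i j hij => (hdisj i.2 j.2 (Subtype.coe_injective.ne hij)).preimage _)
    rw [ht] at this
    exact absurd this (not_le.2 (Order.lt_succ _))
  obtain ⟨s, hs⟩ := (SeparationQuotient.surjective_mk (X := X)).hasRightInverse
  have hD : Dense (Set.range s) := by
    rw [SeparationQuotient.isInducing_mk.dense_iff]
    intro x
    rw [← Set.range_comp, hs.comp_eq_id, Set.range_id, closure_univ]
    exact Set.mem_univ _
  exact (densityNumber_le hD).trans (mk_range_le.trans hQ)

/-- Every family of sets that contains a nonempty subset of each nonempty open set has a disjoint
subfamily with dense union. -/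
theorem exists_pairwiseDisjoint_dense_sUnion {P : Set (Set X)}
    (h : ∀ G : Set X, IsOpen G → G.Nonempty → ∃ V ∈ P, V ⊆ G ∧ V.Nonempty) :
    ∃ S ⊆ P, (∀ V ∈ S, V.Nonempty) ∧ S.PairwiseDisjoint id ∧ Dense (⋃₀ S) := by
  obtain ⟨S, hS⟩ := zorn_subset
    {S : Set (Set X) | S ⊆ P ∧ (∀ V ∈ S, V.Nonempty) ∧ S.PairwiseDisjoint id} (by
      intro c hc hchain
      refine ⟨⋃₀ c, ⟨Set.sUnion_subset fun S hS => (hc hS).1, ?_, ?_⟩,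
        fun S hS => Set.subset_sUnion_of_mem hS⟩
      · rintro V ⟨S, hS, hV⟩
        exact (hc hS).2.1 V hV
      · exact (Set.pairwiseDisjoint_sUnion hchain.directedOn).2 fun S hS => (hc hS).2.2)
  refine ⟨S, hS.prop.1, hS.prop.2.1, hS.prop.2.2, ?_⟩
  rw [dense_iff_inter_open]
  intro G hG hGne
  by_contra hem
  rw [Set.not_nonempty_iff_eq_empty, ← Set.disjoint_iff_inter_eq_empty] at hem
  obtain ⟨V, hVP, hVG, hVne⟩ := h G hG hGne
  have hVS : ∀ W ∈ S, Disjoint V W := fun W hW =>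
    hem.mono hVG (Set.subset_sUnion_of_mem hW)
  -- By maximality `V` already belongs to `S`, so it is disjoint from itself.
  have hins : insert V S ⊆ S := hS.le_of_ge
    ⟨Set.insert_subset hVP hS.prop.1,
      by
        rintro W (rfl | hW)
        exacts [hVne, hS.prop.2.1 W hW],
      hS.prop.2.2.insert fun W hW _ => hVS W hW⟩ (Set.subset_insert V S)
  have := hVS V (hins (Set.mem_insert V S))
  exact hVne.ne_empty (disjoint_self.1 this)

/-- If every nonempty open set contains a nonempty open set of density below `2 ^ pd(X)`, then
`d(X) < 2 ^ pd(X)`. -/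
theorem densityNumber_lt_of_locally (hω : ℵ₀ ≤ pinningDownNumber X)
    (h : ∀ G : Set X, IsOpen G → G.Nonempty → ∃ V ⊆ G, IsOpen V ∧ V.Nonempty ∧
      ∃ D : Set X, #D < (2 : Cardinal.{u}) ^ pinningDownNumber X ∧ V ⊆ closure D) :
    densityNumber X < (2 : Cardinal.{u}) ^ pinningDownNumber X := by
  obtain ⟨S, hSP, hSne, hSd, hSdense⟩ := exists_pairwiseDisjoint_dense_sUnion
    (P := {V : Set X | IsOpen V ∧
      ∃ D : Set X, #D < (2 : Cardinal.{u}) ^ pinningDownNumber X ∧ V ⊆ closure D})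
    (fun G hG hGne => by
      obtain ⟨V, hVG, hV, hVne, hD⟩ := h G hG hGne
      exact ⟨V, ⟨hV, hD⟩, hVG, hVne⟩)
  have hS : #S ≤ pinningDownNumber X :=
    mk_le_pinningDownNumber_of_pairwise_disjoint (V := fun V : S => V.1)
      (fun V => (hSP V.2).1) (fun V => hSne V.1 V.2)
      (fun V W hVW => hSd V.2 W.2 (Subtype.coe_injective.ne hVW))
  choose D hDlt hDV using fun V : S => (hSP V.2).2
  have hdense : Dense (⋃ V, D V) := by
    refine Dense.of_closure (hSdense.mono (Set.sUnion_subset fun V hV => ?_))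
    exact (hDV ⟨V, hV⟩).trans (closure_mono (Set.subset_iUnion D ⟨V, hV⟩))
  calc densityNumber X ≤ #(⋃ V, D V) := densityNumber_le hdense
    _ ≤ Cardinal.sum fun V => #(D V) := mk_iUnion_le_sum_mk
    _ < Cardinal.prod fun _ : S => (2 : Cardinal.{u}) ^ pinningDownNumber X :=
      sum_lt_prod _ _ hDlt
    _ = ((2 : Cardinal.{u}) ^ pinningDownNumber X) ^ #S := prod_const' _ _
    _ ≤ ((2 : Cardinal.{u}) ^ pinningDownNumber X) ^ pinningDownNumber X :=
      power_le_power_left (power_ne_zero _ two_ne_zero) hS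
    _ = (2 : Cardinal.{u}) ^ pinningDownNumber X := by rw [← power_mul, mul_eq_self hω]

/-- If an open set `V` has at most `2 ^ pd(X)` points, and all its nonempty open subsets have at
least as many, then `V` lies in the closure of a set of size at most `pd(X)`. -/
theorem exists_subset_closure_of_mk_le (hω : ℵ₀ ≤ pinningDownNumber X) {V : Set X}
    (hV : IsOpen V) (hcard : #V ≤ (2 : Cardinal.{u}) ^ pinningDownNumber X)
    (hlarge : ∀ W ⊆ V, IsOpen W → W.Nonempty → (2 : Cardinal.{u}) ^ pinningDownNumber X ≤ #W) :
    ∃ A : Set X, #A ≤ pinningDownNumber X ∧ V ⊆ closure A := by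
  by_contra! hA
  have hne : ∀ A : {A : Set X // A ⊆ V ∧ #A ≤ pinningDownNumber X},
      (V \ closure A.1).Nonempty := fun A => Set.sdiff_nonempty.2 (hA A.1 A.2.2)
  have hopen : ∀ A : {A : Set X // A ⊆ V ∧ #A ≤ pinningDownNumber X},
      IsOpen (V \ closure A.1) := fun A => hV.sdiff isClosed_closure
  have hω' : ℵ₀ ≤ (2 : Cardinal.{u}) ^ pinningDownNumber X := hω.trans (cantor _).le
  have hι : #{A : Set X // A ⊆ V ∧ #A ≤ pinningDownNumber X} ≤
      (2 : Cardinal.{u}) ^ pinningDownNumber X := by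
    refine (mk_bounded_subset_le V _).trans ?_
    refine (power_le_power_right (max_le hcard hω')).trans_eq ?_
    rw [← power_mul, mul_eq_self hω]
  obtain ⟨A, hAcard, hAV⟩ := exists_pinning_of_mk_le hopen
    fun A => hι.trans (hlarge _ Set.sdiff_subset (hopen A) (hne A))
  -- `A ∩ V` is itself one of the indices, yet `A` meets `V` outside its closure.
  obtain ⟨x, hxA, hxV, hx⟩ := hAV
    ⟨A ∩ V, Set.inter_subset_right, (mk_le_mk_of_subset Set.inter_subset_left).trans hAcard⟩
  exact hx (subset_closure ⟨hxA, hxV⟩)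

/-- If all nonempty open subsets of `G` have more than `2 ^ pd(X)` points, then `G` has at most
`2 ^ pd(X)` regular open subsets. -/
theorem mk_regularOpen_le (hω : ℵ₀ ≤ pinningDownNumber X) {G : Set X}
    (hlarge : ∀ W ⊆ G, IsOpen W → W.Nonempty → (2 : Cardinal.{u}) ^ pinningDownNumber X < #W) :
    #{V : Set X | V ⊆ G ∧ interior (closure V) = V} ≤
      (2 : Cardinal.{u}) ^ pinningDownNumber X := by
  by_contra! hlt
  -- Exactly the successor of 2^κ many sets: each nonempty difference has more than 2^κ points,
  -- hence at least as many as there are pairs.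
  obtain ⟨S, hSG, hS⟩ := le_mk_iff_exists_subset.1 (Order.succ_le_of_lt hlt)
  have hSopen : ∀ V ∈ S, IsOpen V := fun V hV => (hSG hV).2 ▸ isOpen_interior
  have hω' : ℵ₀ ≤ #S := by
    rw [hS]
    exact (hω.trans (cantor _).le).trans (Order.le_succ _)
  have hι : #{p : S × S // (p.1.1 \ closure p.2.1).Nonempty} ≤ #S :=
    (mk_subtype_le _).trans_eq (by rw [← mul_def, mul_eq_self hω'])
  have hopen : ∀ p : {p : S × S // (p.1.1 \ closure p.2.1).Nonempty},
      IsOpen (p.1.1.1 \ closure p.1.2.1) := fun p =>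
    (hSopen _ p.1.1.2).sdiff isClosed_closure
  obtain ⟨A, hA, hAS⟩ := exists_pinning_of_mk_le hopen fun p => by
    refine hι.trans (hS.trans_le (Order.succ_le_of_lt ?_))
    exact hlarge _ (Set.sdiff_subset.trans (hSG p.1.1.2).1) (hopen p) p.2
  have hsub : ∀ V W : S, V.1 ∩ A = W.1 ∩ A → V.1 ⊆ W.1 := by
    intro V W hVW
    have hcl : V.1 ⊆ closure W.1 := by
      by_contra hn
      obtain ⟨x, hxA, hxV, hxW⟩ := hAS ⟨(V, W), Set.sdiff_nonempty.2 hn⟩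
      have : x ∈ W.1 ∩ A := hVW ▸ ⟨hxV, hxA⟩
      exact hxW (subset_closure this.1)
    rw [← (hSG W.2).2]
    exact interior_maximal hcl (hSopen _ V.2)
  have hinj : Function.Injective fun V : S => ((↑) ⁻¹' V.1 : Set A) := by
    intro V W hVW
    have := Subtype.preimage_coe_eq_preimage_coe_iff.1 hVW
    rw [Set.inter_comm A, Set.inter_comm A] at this
    exact Subtype.ext ((hsub V W this).antisymm (hsub W V this.symm))
  have hle := mk_le_of_injective hinj
  rw [mk_set, hS] at hle
  exact absurd (hle.trans (power_le_power_left two_ne_zero hA)) (not_le.2 (Order.lt_succ _))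

/-- In a regular space, if all nonempty open subsets of the open set `G` have more than
`2 ^ pd(X)` points, then `G` lies in the closure of a set of size at most `pd(X)`. -/
theorem exists_subset_closure_of_lt_mk [RegularSpace X] (hω : ℵ₀ ≤ pinningDownNumber X)
    {G : Set X} (hG : IsOpen G)
    (hlarge : ∀ W ⊆ G, IsOpen W → W.Nonempty → (2 : Cardinal.{u}) ^ pinningDownNumber X < #W) :
    ∃ A : Set X, #A ≤ pinningDownNumber X ∧ G ⊆ closure A := by
  have hopen : ∀ V : {V : {V : Set X | V ⊆ G ∧ interior (closure V) = V} // V.1.Nonempty},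
      IsOpen V.1.1 := fun V => V.1.2.2 ▸ isOpen_interior
  obtain ⟨A, hA, hAV⟩ := exists_pinning_of_mk_le hopen fun V =>
    ((mk_subtype_le _).trans (mk_regularOpen_le hω hlarge)).trans
      (hlarge _ V.1.2.1 (hopen V) V.2).le
  refine ⟨A, hA, fun x hx => mem_closure_iff.2 fun O hO hxO => ?_⟩
  -- The interior of a closed neighborhood is regular open, so it is among the pinned sets.
  obtain ⟨C, hCx, hC, hCO⟩ := exists_mem_nhds_isClosed_subset ((hO.inter hG).mem_nhds ⟨hxO, hx⟩)
  have hsub : interior C ⊆ O ∩ G := interior_subset.trans hCO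
  have hreg : interior (closure (interior C)) = interior C :=
    (interior_mono (closure_minimal interior_subset hC)).antisymm
      (interior_maximal subset_closure isOpen_interior)
  obtain ⟨y, hyA, hyC⟩ := hAV ⟨⟨interior C, hsub.trans Set.inter_subset_right, hreg⟩,
    ⟨x, mem_interior_iff_mem_nhds.2 hCx⟩⟩
  exact ⟨y, (hsub hyC).1, hyA⟩

end PinningDown

theorem mainTheorem5 (X : Type u) [TopologicalSpace X] [RegularSpace X] :
    densityNumber X < (2 : Cardinal.{u}) ^ pinningDownNumber X := by
  rcases lt_or_ge (pinningDownNumber X) ℵ₀ with hfin | hω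
  · exact (densityNumber_le_of_pinningDownNumber_lt_aleph0 hfin).trans_lt (cantor _)
  refine densityNumber_lt_of_locally hω fun G hG hGne => ?_
  by_contra! hbig
  have hlarge : ∀ W ⊆ G, IsOpen W → W.Nonempty →
      (2 : Cardinal.{u}) ^ pinningDownNumber X ≤ #W := fun W hWG hW hWne => by
    by_contra! hlt
    -- A small `W` would serve as its own dense set.
    exact hbig W hWG hW hWne W hlt subset_closure
  by_cases hV : ∃ V ⊆ G, IsOpen V ∧ V.Nonempty ∧ #V ≤ (2 : Cardinal.{u}) ^ pinningDownNumber X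
  · obtain ⟨V, hVG, hV, hVne, hcard⟩ := hV
    obtain ⟨A, hA, hVA⟩ := exists_subset_closure_of_mk_le hω hV hcard
      fun W hW => hlarge W (hW.trans hVG)
    exact hbig V hVG hV hVne A (hA.trans_lt (cantor _)) hVA
  · push Not at hV
    obtain ⟨A, hA, hGA⟩ := exists_subset_closure_of_lt_mk hω hG hV
    exact hbig G subset_rfl hG hGne A (hA.trans_lt (cantor _)) hGA
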